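/- Let $N\ge 0$, let $G$ be a subgroup of the symmetric group $\mathcal S_N$, and let $\chi$ be an irreducible complex character of $G$ (the character of an irreducible finite-dimensional complex representation of $G$). For a real $N\times N$ matrix $M=(m_{ij})$ put \[ d_\chi^G(M)=\sum_{\sigma\in G}\chi(\sigma)\prod_{i=1}^{N} m_{i\,\sigma(i)} . \] Then $d_\chi^G(M)$ is a real number for every real symmetric positive semidefinite matrix $M$, and for all real symmetric positive semidefinite $N\times N$ matrices $A,B,C,X$, \[ \begin{aligned} d_\chi^G(A+X)&+d_\chi^G(B+X)+d_\chi^G(C+X)+d_\chi^G(A+B+C+X)\\ &\ge d_\chi^G(A+B+X)+d_\chi^G(B+C+X)+d_\chi^G(C+A+X)+d_\chi^G(X). \end{aligned} \] In other words, the third differences of $d_\chi^G$ are nonnegative: $\Delta_A\Delta_B\Delta_C\, d_\chi^G(X)\ge 0$, where $(\Delta_H f)(Y)=f(Y+H)-f(Y)$. -/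

import Mathlib

open Classical in
/-- The generalized matrix function `d_χ^G` attached to a subgroup `G` of the symmetric group on
`N` letters and a complex-valued function `χ` on `G`, evaluated at a real `N × N` matrix `A`:
`∑_{σ ∈ G} χ(σ) ∏_i a_{i σ(i)}`. It is called an immanant when `χ` is an irreducible character
of `G`. -/
noncomputable def immanant {N : ℕ} (G : Subgroup (Equiv.Perm (Fin N))) (χ : G → ℂ)
    (A : Matrix (Fin N) (Fin N) ℝ) : ℂ :=
  ∑ σ : G, χ σ * ∏ i, ((A i ((σ : Equiv.Perm (Fin N)) i) : ℝ) : ℂ)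

/-!
Characters are positive definite functions, and the iterated differences of the generalized matrix
function can be written as the pairing of the character with a second positive semidefinite kernel
on the group.

For a real matrix `M` let `K_M` be the `G × G` matrix with entries
`K_M(τ, σ) = ∏ i, M (τ i) (σ i)` (`Matrix.permKernel`). Reindexing the product shows that
`K_M(τ, σ)` is the monomial of the immanant belonging to `σ τ⁻¹`, hence
`|G| d_χ(M) = ∑_{τ, σ} χ(τ⁻¹ σ) K_M(τ, σ)` (`card_mul_immanant`).

* The matrix `χ(τ⁻¹ σ)` is positive semidefinite
  (`Representation.posSemidef_character_inv_mul`): in a basis that makes the representation unitary,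
  the trace of `U(τ)⁻¹ U(σ)` is the inner product of the vectors of matrix entries of `U(τ)` and
  `U(σ)`.
* For positive semidefinite `M` the matrix `K_M` is the entrywise product of the matrices
  `M (τ i) (σ i)`, each of which is positive semidefinite. The Leibniz rule for differences and the
  Schur product theorem show that entrywise products of maps all of whose iterated differences in
  positive semidefinite directions are positive semidefinite have the same property
  (`PosSemidefDiffs.hadamard`). As `M ↦ M (τ i) (σ i)` is additive, all iterated differences of
  `M ↦ K_M` are positive semidefinite.

By the Schur product theorem once more, `|G|` times any iterated difference of `d_χ` is the sum of
the entries of a positive semidefinite complex matrix. Such a sum is real and nonnegative.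
-/

open Matrix
open scoped ComplexOrder

/-! ### Positive definiteness of characters -/

/-- Weyl's unitary trick in matrix form: `L` is a square root of the average of the forms
`(R g)ᴴ * R g`. -/
lemma exists_unitary_conj_of_finite_group {G d : Type*} [Group G] [Fintype G] [Fintype d]
    [DecidableEq d] (R : G →* Matrix d d ℂ) :
    ∃ L : Matrix d d ℂ, IsUnit L.det ∧
      ∀ g, (L * R g * L⁻¹)ᴴ = L * R g⁻¹ * L⁻¹ := by
  classical
  set H : Matrix d d ℂ := ∑ g, (R g)ᴴ * R g with hH
  have hpos : H.PosDef := by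
    rw [hH, ← Finset.add_sum_erase _ _ (Finset.mem_univ (1 : G))]
    refine PosDef.add_posSemidef ?_ (posSemidef_sum _ fun g _ => posSemidef_conjTranspose_mul_self _)
    simpa using (PosDef.one : (1 : Matrix d d ℂ).PosDef)
  have hinv (g : G) : (R g)ᴴ * H * R g = H := by
    rw [hH, Finset.mul_sum, Finset.sum_mul, ← Equiv.sum_comp (Equiv.mulRight g) fun h => (R h)ᴴ * R h]
    refine Finset.sum_congr rfl fun h _ => ?_
    simp [Matrix.mul_assoc]
  obtain ⟨L, hL⟩ : ∃ L : Matrix d d ℂ, H = Lᴴ * L := by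
    open scoped MatrixOrder in
    exact CStarAlgebra.nonneg_iff_eq_star_mul_self.mp (nonneg_iff_posSemidef.mpr hpos.posSemidef)
  have hdet : IsUnit L.det := by
    have := (Matrix.isUnit_iff_isUnit_det _).mp hpos.isUnit
    rw [hL, det_mul] at this
    exact isUnit_of_mul_isUnit_right this
  have hdet' : IsUnit Lᴴ.det := by
    rw [det_conjTranspose]; exact hdet.star
  refine ⟨L, hdet, fun g => ?_⟩
  have hR : R g * R g⁻¹ = 1 := by rw [← map_mul, mul_inv_cancel, map_one]
  have key : (R g)ᴴ * (Lᴴ * L) = Lᴴ * L * R g⁻¹ := by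
    rw [← hL]
    calc (R g)ᴴ * H = (R g)ᴴ * H * (R g * R g⁻¹) := by rw [hR, Matrix.mul_one]
      _ = (R g)ᴴ * H * R g * R g⁻¹ := by simp only [Matrix.mul_assoc]
      _ = H * R g⁻¹ := by rw [hinv]
  calc (L * R g * L⁻¹)ᴴ = (Lᴴ)⁻¹ * ((R g)ᴴ * Lᴴ) := by
        rw [conjTranspose_mul, conjTranspose_mul, conjTranspose_nonsing_inv]
    _ = (Lᴴ)⁻¹ * ((R g)ᴴ * (Lᴴ * L)) * L⁻¹ := by
        simp only [Matrix.mul_assoc, mul_nonsing_inv _ hdet, Matrix.mul_one]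
    _ = L * R g⁻¹ * L⁻¹ := by
        rw [key, Matrix.mul_assoc Lᴴ, nonsing_inv_mul_cancel_left _ _ hdet']

/-- The character of a complex representation of a finite group is a positive definite function. -/
lemma Representation.posSemidef_character_inv_mul {G V : Type*} [Group G] [Fintype G]
    [AddCommGroup V] [Module ℂ V] [FiniteDimensional ℂ V] (ρ : Representation ℂ G V) :
    (Matrix.of fun τ σ : G => ρ.character (τ⁻¹ * σ)).PosSemidef := by
  let b := Module.finBasis ℂ V
  let R : G →* Matrix (Fin (Module.finrank ℂ V)) (Fin (Module.finrank ℂ V)) ℂ :=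
    (LinearMap.toMatrixAlgEquiv b : _ →* _).comp ρ
  have hR (g : G) : ρ.character g = (R g).trace := LinearMap.trace_eq_matrix_trace ℂ b (ρ g)
  obtain ⟨L, hL, hU⟩ := exists_unitary_conj_of_finite_group R
  -- The columns of `F` are the vectors of matrix entries of the unitary matrices `L * R σ * L⁻¹`.
  let F : Matrix (Fin (Module.finrank ℂ V) × Fin (Module.finrank ℂ V)) G ℂ :=
    .of fun p σ => (L * R σ * L⁻¹) p.1 p.2
  convert posSemidef_conjTranspose_mul_self F using 1
  ext τ σ
  have h1 : R (τ⁻¹ * σ) = L⁻¹ * ((L * R τ * L⁻¹)ᴴ * (L * R σ * L⁻¹)) * L := by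
    rw [hU]
    simp only [Matrix.mul_assoc, nonsing_inv_mul _ hL, Matrix.mul_one,
      nonsing_inv_mul_cancel_left _ _ hL, map_mul]
  rw [of_apply, hR, h1, trace_mul_comm, mul_nonsing_inv_cancel_left _ _ hL]
  simp only [trace, diag, mul_apply (M := (_ : Matrix _ _ ℂ)ᴴ), conjTranspose_apply,
    Fintype.sum_prod_type, F, of_apply]
  rw [Finset.sum_comm]

/-! ### Maps with positive semidefinite iterated differences -/

lemma Matrix.PosSemidef.map_ofReal {n : Type*} [Fintype n] {M : Matrix n n ℝ}
    (hM : M.PosSemidef) : (M.map ((↑) : ℝ → ℂ)).PosSemidef := by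
  classical
  obtain ⟨L, rfl⟩ : ∃ L : Matrix n n ℝ, M = Lᴴ * L := by
    open scoped MatrixOrder in
    exact CStarAlgebra.nonneg_iff_eq_star_mul_self.mp (nonneg_iff_posSemidef.mpr hM)
  convert posSemidef_conjTranspose_mul_self (L.map ((↑) : ℝ → ℂ)) using 1
  ext i j
  simp [mul_apply]

/-- `PosSemidefDiffs k F` says that the iterated differences of `F` of order at most `k`, in
positive semidefinite directions and at positive semidefinite base points, are positive
semidefinite. -/
def PosSemidefDiffs {n κ : Type*} : ℕ → (Matrix n n ℝ → Matrix κ κ ℂ) → Prop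
  | 0, F => ∀ X, X.PosSemidef → (F X).PosSemidef
  | k + 1, F => PosSemidefDiffs k F ∧ ∀ H, H.PosSemidef → PosSemidefDiffs k (fwdDiff H F)

namespace PosSemidefDiffs

variable {n κ : Type*} {k : ℕ} {F F' : Matrix n n ℝ → Matrix κ κ ℂ}

lemma posSemidef (hF : PosSemidefDiffs k F) {X : Matrix n n ℝ} (hX : X.PosSemidef) :
    (F X).PosSemidef := by
  induction k with
  | zero => exact hF X hX
  | succ k ih => exact ih hF.1

lemma add (hF : PosSemidefDiffs k F) (hF' : PosSemidefDiffs k F') :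
    PosSemidefDiffs k (F + F') := by
  induction k generalizing F F' with
  | zero => exact fun X hX => (hF X hX).add (hF' X hX)
  | succ k ih =>
    refine ⟨ih hF.1 hF'.1, fun H hH => ?_⟩
    rw [fwdDiff_add]
    exact ih (hF.2 H hH) (hF'.2 H hH)

lemma const {K : Matrix κ κ ℂ} (hK : K.PosSemidef) (k : ℕ) :
    PosSemidefDiffs k (fun _ : Matrix n n ℝ => K) := by
  induction k generalizing K with
  | zero => exact fun _ _ => hK
  | succ k ih =>
    refine ⟨ih hK, fun H _ => ?_⟩
    rw [fwdDiff_const]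
    exact ih PosSemidef.zero

lemma hadamard (hF : PosSemidefDiffs k F) (hF' : PosSemidefDiffs k F') :
    PosSemidefDiffs k (fun X => F X ⊙ F' X) := by
  induction k generalizing F F' with
  | zero => exact fun X hX => (hF X hX).hadamard (hF' X hX)
  | succ k ih =>
    refine ⟨ih hF.1 hF'.1, fun H hH => ?_⟩
    have leibniz : fwdDiff H (fun X => F X ⊙ F' X) =
        (fun X => fwdDiff H F X ⊙ F' X) + (fun X => F X ⊙ fwdDiff H F' X) +
          fun X => fwdDiff H F X ⊙ fwdDiff H F' X := by
      ext X i j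
      simp only [fwdDiff, Pi.add_apply, Matrix.add_apply, Matrix.sub_apply, hadamard_apply]
      ring
    rw [leibniz]
    exact ((ih (hF.2 H hH) hF'.1).add (ih hF.1 (hF'.2 H hH))).add (ih (hF.2 H hH) (hF'.2 H hH))

lemma map_submatrix [Fintype n] (e : κ → n) (k : ℕ) :
    PosSemidefDiffs k (fun X : Matrix n n ℝ => (X.map ((↑) : ℝ → ℂ)).submatrix e e) := by
  induction k with
  | zero => exact fun X hX => hX.map_ofReal.submatrix e
  | succ k ih =>
    refine ⟨ih, fun H hH => ?_⟩
    have hdiff : fwdDiff H (fun X : Matrix n n ℝ => (X.map ((↑) : ℝ → ℂ)).submatrix e e) =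
        fun _ => (H.map ((↑) : ℝ → ℂ)).submatrix e e := by
      ext X i j
      simp [fwdDiff]
    rw [hdiff]
    exact const (hH.map_ofReal.submatrix e) k

end PosSemidefDiffs

/-! ### The kernel of a generalized matrix function -/

/-- The matrix indexed by `G` whose entry at `(τ, σ)` is `∏ i, M (τ i) (σ i)`; it is a principal
submatrix of a tensor power of `M`. -/
noncomputable def Matrix.permKernel {n : Type*} [Fintype n] (G : Subgroup (Equiv.Perm n))
    (M : Matrix n n ℝ) : Matrix G G ℂ :=
  .of fun τ σ => ∏ i, ((M (τ.1 i) (σ.1 i) : ℝ) : ℂ)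

lemma posSemidefDiffs_permKernel {n : Type*} [Fintype n] (G : Subgroup (Equiv.Perm n)) (k : ℕ) :
    PosSemidefDiffs k (permKernel G) := by
  classical
  have h (s : Finset n) : PosSemidefDiffs k (fun M : Matrix n n ℝ =>
      (.of fun τ σ => ∏ i ∈ s, ((M (τ.1 i) (σ.1 i) : ℝ) : ℂ) : Matrix G G ℂ)) := by
    induction s using Finset.induction_on with
    | empty =>
      -- The empty product is the all-ones matrix `1 1ᴴ`.
      convert PosSemidefDiffs.const (posSemidef_vecMulVec_self_star (1 : G → ℂ)) k using 2 with M
      ext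
      simp [vecMulVec_apply]
    | insert i s hi ih =>
      convert (PosSemidefDiffs.map_submatrix (fun τ : G => τ.1 i) k).hadamard ih using 2
      ext
      simp [Finset.prod_insert hi]
  exact h Finset.univ

lemma card_mul_immanant {N : ℕ} (G : Subgroup (Equiv.Perm (Fin N))) [Fintype G] {χ : G → ℂ}
    (hχ : ∀ g h, χ (g * h) = χ (h * g)) (M : Matrix (Fin N) (Fin N) ℝ) :
    (Fintype.card G : ℂ) * immanant G χ M = ∑ τ, ∑ σ, χ (τ⁻¹ * σ) * permKernel G M τ σ := by
  have h (τ : G) : ∑ σ, χ (τ⁻¹ * σ) * permKernel G M τ σ = immanant G χ M := by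
    rw [← Equiv.sum_comp (Equiv.mulRight τ)]
    unfold immanant
    refine Finset.sum_congr (by ext; simp) fun σ _ => ?_
    rw [Equiv.coe_mulRight, hχ, mul_inv_cancel_right]
    congr 1
    exact Equiv.prod_comp τ.1 fun i => ((M i (σ.1 i) : ℝ) : ℂ)
  simp [h]

/-- The additive functional sending a kernel `K` on `G` to the sum of the entries of its entrywise
product with `χ(τ⁻¹ σ)`, divided by `|G|`; it sends `permKernel G M` to the immanant of `M`. -/
noncomputable def characterPairing {G V : Type*} [Group G] [Fintype G] [AddCommGroup V] [Module ℂ V]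
    (ρ : Representation ℂ G V) : Matrix G G ℂ →+ ℂ where
  toFun K := (Fintype.card G : ℂ)⁻¹ * ∑ τ, ∑ σ, ρ.character (τ⁻¹ * σ) * K τ σ
  map_zero' := by simp
  map_add' K K' := by simp [mul_add, Finset.sum_add_distrib]

lemma characterPairing_nonneg {G V : Type*} [Group G] [Fintype G] [AddCommGroup V] [Module ℂ V]
    [FiniteDimensional ℂ V] (ρ : Representation ℂ G V) {K : Matrix G G ℂ} (hK : K.PosSemidef) :
    0 ≤ characterPairing ρ K := by
  have h := (ρ.posSemidef_character_inv_mul.hadamard hK).dotProduct_mulVec_nonneg 1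
  simp only [dotProduct, mulVec, hadamard_apply, of_apply, Pi.star_apply, Pi.one_apply, star_one,
    one_mul, mul_one] at h
  exact mul_nonneg (by positivity) h

lemma immanant_character_eq {N : ℕ} (G : Subgroup (Equiv.Perm (Fin N))) [Fintype G] {V : Type*}
    [AddCommGroup V] [Module ℂ V] (ρ : Representation ℂ G V) :
    immanant G ρ.character = fun M => characterPairing ρ (permKernel G M) := by
  ext M
  simp only [characterPairing, AddMonoidHom.coe_mk, ZeroHom.coe_mk,
    ← card_mul_immanant G (fun g h => ρ.char_mul_comm h g) M]
  rw [inv_mul_cancel_left₀ (by simp)]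

lemma fwdDiff_comp_addMonoidHom {M A B : Type*} [AddCommMonoid M] [AddCommGroup A]
    [AddCommGroup B] (φ : A →+ B) (h : M) (f : M → A) :
    fwdDiff h (fun x => φ (f x)) = fun x => φ (fwdDiff h f x) := by
  ext x
  simp [fwdDiff]

theorem mainTheorem4 {N : ℕ} (G : Subgroup (Equiv.Perm (Fin N)))
    {V : Type*} [AddCommGroup V] [Module ℂ V] [FiniteDimensional ℂ V]
    (ρ : Representation ℂ G V) (hρ : ρ.IsIrreducible) (χ : G → ℂ) (hχ : χ = ρ.character) :
    (∀ M : Matrix (Fin N) (Fin N) ℝ, M.PosSemidef → (immanant G χ M).im = 0) ∧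
    ∀ A B C X : Matrix (Fin N) (Fin N) ℝ,
      A.PosSemidef → B.PosSemidef → C.PosSemidef → X.PosSemidef →
      (immanant G χ (A + B + X)).re + (immanant G χ (B + C + X)).re +
          (immanant G χ (C + A + X)).re + (immanant G χ X).re ≤
        (immanant G χ (A + X)).re + (immanant G χ (B + X)).re +
          (immanant G χ (C + X)).re + (immanant G χ (A + B + C + X)).re ∧
      0 ≤ (fwdDiff A (fwdDiff B (fwdDiff C (immanant G χ))) X).re := by
  classical
  have : Fintype G := Fintype.ofFinite G
  subst hχ
  have hdiffs := posSemidefDiffs_permKernel G 3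
  refine ⟨fun M hM => ?_, fun A B C X hA hB hC hX => ?_⟩
  · rw [immanant_character_eq]
    exact (Complex.nonneg_iff.mp (characterPairing_nonneg ρ (hdiffs.posSemidef hM))).2.symm
  · have h : 0 ≤ (fwdDiff A (fwdDiff B (fwdDiff C (immanant G ρ.character))) X).re := by
      rw [immanant_character_eq, fwdDiff_comp_addMonoidHom, fwdDiff_comp_addMonoidHom,
        fwdDiff_comp_addMonoidHom]
      exact (Complex.nonneg_iff.mp (characterPairing_nonneg ρ
        (((hdiffs.2 C hC).2 B hB).2 A hA X hX))).1
    refine ⟨?_, h⟩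
    simp only [fwdDiff, Complex.sub_re] at h
    rw [show A + B + X = X + A + B by abel, show B + C + X = X + B + C by abel,
      show C + A + X = X + A + C by abel, show A + X = X + A by abel,
      show B + X = X + B by abel, show C + X = X + C by abel,
      show A + B + C + X = X + A + B + C by abel]
    linarith
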